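/- Let $k$ be a field, $G$ a group, and $A=\bigoplus_{g\in G}A_g$ a finite dimensional strongly $G$-graded $k$-algebra (i.e. $A_gA_h=A_{gh}$ for all $g,h\in G$), with $1$-component $B=A_1$. Let $\mathrm{Res}^A_B$ denote restriction of scalars from $A$ to $B$, for left and for right modules. For a finite dimensional $k$-algebra $R$ and a finitely generated left $R$-module $M$, let $\mathrm{D}M=\mathrm{Hom}_k(M,k)$, a right $R$-module (similarly, the $k$-dual of a right $R$-module is a left $R$-module), let $\nu_R(M)=\mathrm{D}\,\mathrm{Hom}_R(M,R)$, let $\mathrm{Tr}_R M=\mathrm{Coker}\big(\mathrm{Hom}_R(P_0,R)\to\mathrm{Hom}_R(P_1,R)\big)$, where $P_1\to P_0\to M\to 0$ is a minimal projective presentation of $M$, and let $\tau_R(M)=\mathrm{D}\,\mathrm{Tr}_R M$. Let $X$ be a finitely generated left $A$-module. Then: 1) $\mathrm{D}(\mathrm{Res}^A_B X)\simeq \mathrm{Res}^A_B\,\mathrm{D}X$ as right $B$-modules. 2) $\mathrm{Hom}_B(\mathrm{Res}^A_B X,B)\simeq \mathrm{Res}^A_B\,\mathrm{Hom}_A(X,A)$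 as right $B$-modules. 3) $\nu_B(\mathrm{Res}^A_B X)\simeq \mathrm{Res}^A_B\,\nu_A(X)$ as left $B$-modules. 4) If $B$ is self-injective and $|G|$ is invertible in $k$, then $\mathrm{Tr}_B(\mathrm{Res}^A_B X)\simeq \mathrm{Res}^A_B\,\mathrm{Tr}_A X$ as right $B$-modules. 5) If $B$ is self-injective and $|G|$ is invertible in $k$, then $\tau_B(\mathrm{Res}^A_B X)\simeq \mathrm{Res}^A_B\,\tau_A(X)$ as left $B$-modules. -/

import Mathlib

universe w u v

namespace GrRes

open CategoryTheory
open scoped ModuleCat.Algebra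

/-! ### Strongly graded algebras, self-injective rings -/

section Graded

variable {k : Type w} [Field k] {A : Type u} [Ring A] [Algebra k A] {G : Type v} [Group G]

/-- A `G`-grading of `A` (indexed by `Additive G`, since Mathlib writes the index monoid of a
grading additively) is strong if `A_g A_h = A_{gh}` for all `g h : G`. The product of two subspaces
is the span of the products of their elements. -/
def IsStronglyGraded (𝒜 : Additive G → Submodule k A) : Prop :=
  ∀ g h : G, 𝒜 (.ofMul g) * 𝒜 (.ofMul h) = 𝒜 (.ofMul (g * h))

/-- The component of degree `1 : G` of a `G`-graded algebra, as a subalgebra. -/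
abbrev oneComponent [DecidableEq G] (𝒜 : Additive G → Submodule k A) [GradedAlgebra 𝒜] :
    Subalgebra k A :=
  SetLike.GradeZero.subalgebra 𝒜

/-- A ring is (left) self-injective if it is injective as a left module over itself. -/
def IsSelfInjective (R : Type u) [Ring R] : Prop :=
  Module.Injective R R

end Graded

/-! ### Restriction. Right `A`-modules are left modules over `Aᵐᵒᵖ`. -/

section Restriction

variable {k : Type w} [Field k] {A : Type u} [Ring A] [Algebra k A]

/-- Restriction of a left `A`-module to a subalgebra `B` of `A`. -/
noncomputable abbrev res (B : Subalgebra k A) (X : ModuleCat.{v} A) : ModuleCat.{v} B :=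
  (ModuleCat.restrictScalars (B.val : B →+* A)).obj X

/-- Restriction of a right `A`-module to a subalgebra `B` of `A`. -/
noncomputable abbrev resRight (B : Subalgebra k A) (Y : ModuleCat.{v} Aᵐᵒᵖ) : ModuleCat.{v} (↥B)ᵐᵒᵖ :=
  (ModuleCat.restrictScalars (RingHom.op (B.val : B →+* A))).obj Y

/-- A finitely generated module over a finite dimensional algebra is finitely generated over every
subalgebra. -/
instance finite_res [FiniteDimensional k A] (B : Subalgebra k A) (X : ModuleCat.{v} A)
    [Module.Finite A X] : Module.Finite B (res B X) := by
  have : Module.Finite k X := Module.Finite.trans A X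
  have : Module.Finite k (res B X) := ‹Module.Finite k X›
  exact Module.Finite.of_restrictScalars_finite k B _

end Restriction

/-! ### The dualities and the Nakayama functor

A (left or right) `A`-module is a `k`-vector space through `k → A`. -/

section Duals

variable (k : Type w) [Field k] {A : Type u} [Ring A] [Algebra k A]

/-- The right `A`-module structure on `Hom_k(X, k)` of a left `A`-module `X`:
`(f a)(x) = f (a x)`. -/
@[reducible] def kDualModule (X : ModuleCat.{v} A) : Module Aᵐᵒᵖ (X →ₗ[k] k) where
  smul a f :=
    { toFun := fun x => f (a.unop • x)
      map_add' := fun x y => by rw [smul_add, map_add]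
      map_smul' := fun c x => by rw [smul_comm, map_smul, RingHom.id_apply] }
  one_smul f := LinearMap.ext fun x => congrArg f (one_smul A x)
  mul_smul a b f := LinearMap.ext fun x => congrArg f (mul_smul b.unop a.unop x)
  smul_zero a := LinearMap.ext fun _ => rfl
  smul_add a f g := LinearMap.ext fun _ => rfl
  add_smul a b f := LinearMap.ext fun x =>
    (congrArg f (add_smul a.unop b.unop x)).trans (map_add f _ _)
  zero_smul f := LinearMap.ext fun x => (congrArg f (zero_smul A x)).trans (map_zero f)

/-- The `k`-dual `D X = Hom_k(X, k)` of a left `A`-module, a right `A`-module. -/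
def kDual (X : ModuleCat.{v} A) : ModuleCat.{max v w} Aᵐᵒᵖ :=
  letI := kDualModule k X
  ModuleCat.of Aᵐᵒᵖ (X →ₗ[k] k)

/-- The left `A`-module structure on `Hom_k(Y, k)` of a right `A`-module `Y`:
`(a f)(y) = f (y a)`. -/
@[reducible] def kDualRightModule (Y : ModuleCat.{v} Aᵐᵒᵖ) : Module A (Y →ₗ[k] k) where
  smul a f :=
    { toFun := fun y => f (MulOpposite.op a • y)
      map_add' := fun x y => by rw [smul_add, map_add]
      map_smul' := fun c x => by rw [smul_comm, map_smul, RingHom.id_apply] }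
  one_smul f := LinearMap.ext fun y => congrArg f (one_smul Aᵐᵒᵖ y)
  mul_smul a b f := LinearMap.ext fun y =>
    congrArg f (mul_smul (MulOpposite.op b) (MulOpposite.op a) y)
  smul_zero a := LinearMap.ext fun _ => rfl
  smul_add a f g := LinearMap.ext fun _ => rfl
  add_smul a b f := LinearMap.ext fun y =>
    (congrArg f (add_smul (MulOpposite.op a) (MulOpposite.op b) y)).trans (map_add f _ _)
  zero_smul f := LinearMap.ext fun y => (congrArg f (zero_smul Aᵐᵒᵖ y)).trans (map_zero f)

/-- The `k`-dual `D Y = Hom_k(Y, k)` of a right `A`-module, a left `A`-module. -/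
def kDualRight (Y : ModuleCat.{v} Aᵐᵒᵖ) : ModuleCat.{max v w} A :=
  letI := kDualRightModule k Y
  ModuleCat.of A (Y →ₗ[k] k)

/-- The `R`-dual `X^* = Hom_R(X, R)` of a left `R`-module, a right `R`-module:
`(f a)(x) = f(x) a`. -/
abbrev ringDual {R : Type u} [Ring R] (X : ModuleCat.{v} R) : ModuleCat.{max v u} Rᵐᵒᵖ :=
  ModuleCat.of Rᵐᵒᵖ (X →ₗ[R] R)

/-- The Nakayama functor `ν = D Hom_A(-, A)` (on objects). -/
noncomputable def nakayama (X : ModuleCat.{v} A) : ModuleCat.{max v u w} A :=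
  kDualRight k (ringDual X)

end Duals

/-! ### Minimal projective presentations -/

section Presentations

variable {R : Type u} [Ring R]

/-- A surjection `π : P → M` from a finitely generated projective module is a projective cover if
its kernel is superfluous: `L + ker π = P` forces `L = P`. -/
structure IsProjectiveCover {P : Type*} {M : Type*} [AddCommGroup P] [Module R P] [AddCommGroup M]
    [Module R M] (π : P →ₗ[R] M) : Prop where
  finite : Module.Finite R P
  projective : Module.Projective R P
  surjective : Function.Surjective π
  superfluous : ∀ L : Submodule R P, L ⊔ LinearMap.ker π = ⊤ → L = ⊤

variable (R) in
/-- A minimal projective presentation `P₁ → P₀ → M → 0`: the map `P₀ → M` is a projective cover of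
`M`, and `P₁ → P₀` is a projective cover of its kernel. -/
structure MinimalPresentation (M : Type v) [AddCommGroup M] [Module R M] where
  P₁ : ModuleCat.{u} R
  P₀ : ModuleCat.{u} R
  d : P₁ →ₗ[R] P₀
  ε : P₀ →ₗ[R] M
  exact : LinearMap.range d = LinearMap.ker ε
  cover₀ : IsProjectiveCover ε
  cover₁ : IsProjectiveCover d.rangeRestrict

/-- The map `d^* : P₀^* → P₁^*`, `f ↦ f ∘ d`, of right `R`-modules. -/
def MinimalPresentation.dualMap {M : Type v} [AddCommGroup M] [Module R M]
    (p : MinimalPresentation R M) : (p.P₀ →ₗ[R] R) →ₗ[Rᵐᵒᵖ] (p.P₁ →ₗ[R] R) where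
  toFun f := f ∘ₗ p.d
  map_add' _ _ := rfl
  map_smul' _ _ := rfl

/-- The cokernel of `d^* : P₀^* → P₁^*`, a right `R`-module. -/
def MinimalPresentation.cokerDual {M : Type v} [AddCommGroup M] [Module R M]
    (p : MinimalPresentation R M) : ModuleCat.{u} Rᵐᵒᵖ :=
  ModuleCat.of Rᵐᵒᵖ ((p.P₁ →ₗ[R] R) ⧸ LinearMap.range p.dualMap)

/-- Finitely generated modules over an Artinian ring have projective covers. -/
theorem exists_isProjectiveCover [IsArtinianRing R] (M : Type v) [AddCommGroup M] [Module R M]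
    [Module.Finite R M] :
    ∃ (P : ModuleCat.{u} R) (π : P →ₗ[R] M), IsProjectiveCover π := by
  let S : Set ℕ∞ := {n | ∃ (P : ModuleCat.{u} R) (π : P →ₗ[R] M), Module.Finite R P ∧
    Module.Projective R P ∧ Function.Surjective π ∧ Module.length R P = n}
  have hS : S.Nonempty := by
    obtain ⟨n, f, hf⟩ := Module.Finite.exists_fin' R M
    exact ⟨_, ModuleCat.of R (Fin n → R), f, inferInstanceAs (Module.Finite R (Fin n → R)),
      inferInstanceAs (Module.Projective R (Fin n → R)), hf, rfl⟩
  obtain ⟨P, π, hfin, hproj, hsurj, hlen⟩ := WellFounded.min_mem wellFounded_lt S hS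
  refine ⟨P, π, hfin, hproj, hsurj, fun L hL => ?_⟩
  by_contra hne
  have hLs : Function.Surjective (π ∘ₗ L.subtype) := by
    intro m
    obtain ⟨x, rfl⟩ := hsurj m
    have hx : x ∈ L ⊔ LinearMap.ker π := hL ▸ Submodule.mem_top
    obtain ⟨y, hy, z, hz, rfl⟩ := Submodule.mem_sup.1 hx
    exact ⟨⟨y, hy⟩, by simp [LinearMap.mem_ker.1 hz]⟩
  obtain ⟨φ, hφ⟩ := Module.projective_lifting_property (π ∘ₗ L.subtype) π hLs
  let ψ : Module.End R P := L.subtype ∘ₗ φ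
  have hψ : ∀ x, π (ψ x) = π x := fun x => LinearMap.congr_fun hφ x
  have hψn : ∀ (n : ℕ) (x : P), π ((ψ ^ n) x) = π x := by
    intro n
    induction n with
    | zero => intro x; rfl
    | succ n ih => intro x; rw [pow_succ, Module.End.mul_apply, ih, hψ]
  obtain ⟨n, hn, hn1⟩ :=
    (ψ.eventually_isCompl_ker_pow_range_pow.and (Filter.eventually_ge_atTop 1)).exists
  have hle : LinearMap.range (ψ ^ n) ≤ L := by
    rintro _ ⟨x, rfl⟩
    obtain ⟨m, rfl⟩ : ∃ m, n = m + 1 := ⟨n - 1, by omega⟩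
    rw [pow_succ', Module.End.mul_apply]
    exact (φ _).2
  have hNtop : LinearMap.range (ψ ^ n) ≠ ⊤ := fun h => hne (top_le_iff.1 (h ▸ hle))
  have hlt : Module.length R (LinearMap.range (ψ ^ n)) < Module.length R P :=
    Submodule.length_lt hNtop
  refine WellFounded.not_lt_min wellFounded_lt S (x := Module.length R (LinearMap.range (ψ ^ n)))
    ⟨ModuleCat.of R (LinearMap.range (ψ ^ n)), π ∘ₗ (LinearMap.range (ψ ^ n)).subtype, ?_, ?_, ?_,
      rfl⟩ (hlen ▸ hlt)
  · exact Module.Finite.range _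
  · exact Module.Projective.of_split (LinearMap.range (ψ ^ n)).subtype
      (Submodule.projectionOnto _ _ hn.symm)
      (LinearMap.ext fun x => Submodule.projectionOnto_apply_left hn.symm x)
  · intro m
    obtain ⟨x, rfl⟩ := hsurj m
    exact ⟨⟨_, x, rfl⟩, hψn n x⟩

/-- Finitely generated modules over an Artinian ring have minimal projective presentations. -/
theorem nonempty_minimalPresentation [IsArtinianRing R] (M : Type v) [AddCommGroup M] [Module R M]
    [Module.Finite R M] : Nonempty (MinimalPresentation R M) := by
  obtain ⟨P₀, ε, h₀⟩ := exists_isProjectiveCover (R := R) M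
  have := h₀.finite
  obtain ⟨P₁, ρ, h₁⟩ := exists_isProjectiveCover (R := R) (LinearMap.ker ε)
  have hr : LinearMap.range ((LinearMap.ker ε).subtype ∘ₗ ρ) = LinearMap.ker ε := by
    rw [LinearMap.range_comp_of_range_eq_top _ (LinearMap.range_eq_top.2 h₁.surjective),
      Submodule.range_subtype]
  refine ⟨⟨P₁, P₀, (LinearMap.ker ε).subtype ∘ₗ ρ, ε, hr, h₀, h₁.finite, h₁.projective,
    LinearMap.surjective_rangeRestrict _, fun L hL => h₁.superfluous L ?_⟩⟩
  rw [← hL, LinearMap.ker_rangeRestrict, LinearMap.ker_comp_of_ker_eq_bot _ (Submodule.ker_subtype _)]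

end Presentations

/-! ### Transpose and Auslander-Reiten translation -/

section Translation

variable (k : Type w) [Field k] {A : Type u} [Ring A] [Algebra k A] [FiniteDimensional k A]

/-- A minimal projective presentation of a finitely generated module over a finite dimensional
algebra (unique up to isomorphism). -/
noncomputable def minimalPresentation (X : ModuleCat.{v} A) [Module.Finite A X] :
    MinimalPresentation A X :=
  haveI : IsArtinianRing A := IsArtinianRing.of_finite k A
  (nonempty_minimalPresentation (R := A) X).some

/-- The transpose `Tr X = Coker (P₀^* → P₁^*)`, a right `A`-module, where `P₁ → P₀ → X → 0` is a
minimal projective presentation. -/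
noncomputable def transpose (X : ModuleCat.{v} A) [Module.Finite A X] : ModuleCat.{u} Aᵐᵒᵖ :=
  (minimalPresentation k X).cokerDual

/-- The Auslander-Reiten translation `τ X = D Tr X`. -/
noncomputable def arTranslation (X : ModuleCat.{v} A) [Module.Finite A X] :
    ModuleCat.{max u w} A :=
  kDualRight k (transpose k X)

end Translation

end GrRes

/-! Write B for the component of degree 1. A strong grading puts 1 in A_g A_{g⁻¹}, so 1 = ∑_j u_{gj}
v_{gj} with u_{gj} ∈ A_g and v_{gj} ∈ A_{g⁻¹}; everything is built from these families. When G is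
finite, which finite dimension forces unless A = 0, the trace f ↦ ∑ u f(v ·) turns B-linear maps
into A-linear ones. It shows that composition with the projection A → B is a natural bijection
Hom_A(X, A) → Hom_B(X, B) (`dualRestrict_bijective`). The k-dual commutes with restriction on the
nose, hence so does the Nakayama functor.

For the transpose, a minimal projective presentation over A is shown to restrict to one over B.
Projectivity survives because A is projective over B (`projective_self`). Minimality survives
(`superfluous_zero`) because |G| is invertible: by a Maschke averaging argument, A-modules that are
semisimple over B are semisimple over A. Uniqueness of minimal presentations and naturality of the
Hom bijection identify the two cokernels, and dualizing gives τ. -/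

namespace GrRes

open CategoryTheory
open scoped ModuleCat.Algebra

/-! ### Strong gradings and the projection to degree zero (degrees are written additively). -/

section StronglyGraded

variable {k : Type w} [Field k] {A : Type u} [Ring A] [Algebra k A]

/-- Homogeneous families `u_{ij} ∈ A_i`, `v_{ij} ∈ A_{-i}` with `∑_j u_{ij} v_{ij} = 1` for every
degree `i`. -/
structure HomogeneousDualBasis {ι : Type*} [AddGroup ι] (𝒜 : ι → Submodule k A) where
  size : ι → ℕ
  u : ∀ i, Fin (size i) → A
  v : ∀ i, Fin (size i) → A
  u_mem : ∀ i j, u i j ∈ 𝒜 i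
  v_mem : ∀ i j, v i j ∈ 𝒜 (-i)
  sum_mul : ∀ i, ∑ j, u i j * v i j = 1

theorem _root_.Submodule.exists_sum_mul_of_mem_mul {M N : Submodule k A} {a : A} (ha : a ∈ M * N) :
    ∃ (n : ℕ) (x y : Fin n → A), (∀ j, x j ∈ M) ∧ (∀ j, y j ∈ N) ∧ ∑ j, x j * y j = a := by
  induction ha using Submodule.mul_induction_on' with
  | mem_mul_mem m hm n hn => exact ⟨1, fun _ => m, fun _ => n, fun _ => hm, fun _ => hn, by simp⟩
  | add a _ b _ iha ihb =>
    obtain ⟨n, x, y, hx, hy, rfl⟩ := iha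
    obtain ⟨n', x', y', hx', hy', rfl⟩ := ihb
    refine ⟨n + n', Fin.append x x', Fin.append y y', fun j => ?_, fun j => ?_, ?_⟩
    · induction j using Fin.addCases <;> simp [hx, hx']
    · induction j using Fin.addCases <;> simp [hy, hy']
    · simp [Fin.sum_univ_add]

section AddGroup

variable {ι : Type*} [AddGroup ι] [DecidableEq ι] (𝒜 : ι → Submodule k A) [GradedAlgebra 𝒜]

theorem nonempty_homogeneousDualBasis (h : ∀ i j, 𝒜 i * 𝒜 j = 𝒜 (i + j)) :
    Nonempty (HomogeneousDualBasis 𝒜) := by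
  have key : ∀ i, ∃ (n : ℕ) (x y : Fin n → A),
      (∀ j, x j ∈ 𝒜 i) ∧ (∀ j, y j ∈ 𝒜 (-i)) ∧ ∑ j, x j * y j = 1 := fun i =>
    Submodule.exists_sum_mul_of_mem_mul
      (by rw [h, add_neg_cancel]; exact SetLike.one_mem_graded 𝒜)
  choose n x y hx hy hxy using key
  exact ⟨⟨n, x, y, hx, hy, hxy⟩⟩

local notation "B₀" => SetLike.GradeZero.subalgebra 𝒜

/-- The projection of a graded algebra to its component of degree `0`, as a map of left modules
over that component. -/
def projZero : A →ₗ[B₀] B₀ where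
  toFun a := ⟨DirectSum.decompose 𝒜 a 0, (DirectSum.decompose 𝒜 a 0).2⟩
  map_add' a b := Subtype.ext (by simp)
  map_smul' b a := Subtype.ext (by
    have hb : (b : A) ∈ 𝒜 0 := b.2
    have := DirectSum.coe_decompose_mul_add_of_left_mem 𝒜 (j := 0) (b := a) hb
    rwa [add_zero] at this)

theorem coe_projZero (a : A) : (projZero 𝒜 a : A) = DirectSum.decompose 𝒜 a 0 := rfl

theorem projZero_mul_coe (a : A) (b : B₀) : projZero 𝒜 (a * b) = projZero 𝒜 a * b :=
  Subtype.ext (by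
    have hb : (b : A) ∈ 𝒜 0 := b.2
    have := DirectSum.coe_decompose_mul_add_of_right_mem 𝒜 (i := 0) (a := a) hb
    rwa [add_zero] at this)

theorem projZero_coe (b : B₀) : projZero 𝒜 (b : A) = b :=
  Subtype.ext (DirectSum.decompose_of_mem_same 𝒜 b.2)

theorem projZero_of_mem_ne {i : ι} {a : A} (ha : a ∈ 𝒜 i) (hi : i ≠ 0) : projZero 𝒜 a = 0 :=
  Subtype.ext (DirectSum.decompose_of_mem_ne 𝒜 ha hi)

/-- Only the component of `a` of degree `-i` contributes to degree `0` of the product. -/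
theorem coe_projZero_mul {i : ι} (a : A) {b : A} (hb : b ∈ 𝒜 i) :
    (projZero 𝒜 (a * b) : A) = DirectSum.decompose 𝒜 a (-i) * b := by
  rw [coe_projZero, ← DirectSum.coe_decompose_mul_add_of_right_mem 𝒜 hb, neg_add_cancel]

theorem coe_projZero_mul' {i : ι} {a : A} (b : A) (ha : a ∈ 𝒜 i) :
    (projZero 𝒜 (a * b) : A) = a * DirectSum.decompose 𝒜 b (-i) := by
  rw [coe_projZero, ← DirectSum.coe_decompose_mul_add_of_left_mem 𝒜 ha, add_neg_cancel]

variable {𝒜}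

theorem sum_decompose_neg [Fintype ι] (a : A) :
    ∑ i, (DirectSum.decompose 𝒜 a (-i) : A) = a := by
  rw [Fintype.sum_equiv (Equiv.neg ι) (fun i => (DirectSum.decompose 𝒜 a (-i) : A))
    (fun i => (DirectSum.decompose 𝒜 a i : A)) fun _ => rfl]
  classical
  conv_rhs => rw [← DirectSum.sum_support_decompose 𝒜 a]
  symm
  apply Finset.sum_subset (Finset.subset_univ _)
  intro i _ hi
  simpa using hi

namespace HomogeneousDualBasis

variable (s : HomogeneousDualBasis 𝒜)

/-- No component vanishes, since otherwise `∑ u v = 1` would read `0 = 1`; and a finite dimensional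
space has only finitely many independent nonzero subspaces. -/
theorem finite_index (s : HomogeneousDualBasis 𝒜) [FiniteDimensional k A] [Nontrivial A] :
    Finite ι := by
  have h : ∀ i, 𝒜 i ≠ ⊥ := fun i hi => by
    have h1 := s.sum_mul i
    have hu : ∀ j, s.u i j = 0 := fun j => by
      have := s.u_mem i j
      rwa [hi, Submodule.mem_bot] at this
    simp [hu] at h1
  have := WellFoundedGT.finite_ne_bot_of_iSupIndep
    (DirectSum.Decomposition.isInternal 𝒜).submodule_iSupIndep
  simp only [ne_eq, h, not_false_eq_true, Set.ofPred_true] at this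
  exact Set.finite_univ_iff.1 this

/-! ### The trace from B-linear to A-linear maps. -/

section Trace

variable {M N : Type*} [AddCommGroup M] [AddCommGroup N] [Module A M] [Module A N]

/-- Multiplication by `a` of degree `j` carries the degree `i` part of the trace to the degree `j +
i` part. Expand `x = ∑ u_i v_i x`: the coefficients `v_{j+i} a u_i` have degree `0`, so they pass
through `f`, and `∑ u_{j+i} v_{j+i} = 1` absorbs the outer sum. -/
theorem sum_smul_map_smul {i j : ι} {a : A} (ha : a ∈ 𝒜 j) (f : M →ₗ[B₀] N) (x : M) :
    ∑ l, s.u (j + i) l • f (s.v (j + i) l • a • x) = a • ∑ l, s.u i l • f (s.v i l • x) := by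
  have hx : ∀ y : M, y = ∑ l, s.u i l • s.v i l • y := fun y => by
    simp_rw [← mul_smul, ← Finset.sum_smul, s.sum_mul, one_smul]
  have hB : ∀ l l', s.v (j + i) l * a * s.u i l' ∈ B₀ := fun l l' => by
    have := SetLike.mul_mem_graded (SetLike.mul_mem_graded (s.v_mem (j + i) l) ha) (s.u_mem i l')
    have h0 : -(j + i) + j + i = 0 := by rw [add_assoc, neg_add_cancel]
    rwa [h0] at this
  have hf : ∀ l, f (s.v (j + i) l • a • x) =
      ∑ l', (s.v (j + i) l * a * s.u i l') • f (s.v i l' • x) := fun l => by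
    conv_lhs => rw [hx x]
    rw [Finset.smul_sum, Finset.smul_sum, map_sum]
    refine Finset.sum_congr rfl fun l' _ => ?_
    have := f.map_smul ⟨_, hB l l'⟩ (s.v i l' • x)
    rw [Subalgebra.smul_def, Subalgebra.smul_def] at this
    rw [← this]
    simp only [mul_smul]
  simp_rw [hf, Finset.smul_sum]
  rw [Finset.sum_comm]
  refine Finset.sum_congr rfl fun l' _ => ?_
  simp_rw [← mul_smul, ← Finset.sum_smul, ← mul_assoc, ← Finset.sum_mul, s.sum_mul, one_mul]

variable [Fintype ι]

/-- The trace `x ↦ ∑ u_{ij} f(v_{ij} x)` of a map of modules over the component of degree `0`. -/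
def trace (f : M →ₗ[B₀] N) : M →ₗ[A] N where
  toFun x := ∑ i, ∑ j, s.u i j • f (s.v i j • x)
  map_add' x y := by simp only [smul_add, map_add, Finset.sum_add_distrib]
  map_smul' a x := by
    rw [RingHom.id_apply]
    induction a using DirectSum.Decomposition.inductionOn 𝒜 with
    | zero => simp
    | @homogeneous i a =>
      -- Left translation by the degree of `a` permutes the summands.
      rw [Finset.smul_sum]
      exact (Fintype.sum_equiv (Equiv.addLeft i) _ _ fun i' =>
        (s.sum_smul_map_smul a.2 f x).symm).symm
    | add a b ha hb =>
      simp only [add_smul, ← ha, ← hb, smul_add, map_add, Finset.sum_add_distrib]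

theorem trace_apply (f : M →ₗ[B₀] N) (x : M) :
    s.trace f x = ∑ i, ∑ j, s.u i j • f (s.v i j • x) := rfl

/-- `K` contains every `v x`, so `f` may be replaced by `g` there and each degree contributes `∑ u v
g(x) = g(x)`. -/
theorem trace_apply_of_mem {f : M →ₗ[B₀] N} {K : Submodule A M} (g : M →ₗ[A] N)
    (h : ∀ x ∈ K, f x = g x) {x : M} (hx : x ∈ K) : s.trace f x = Fintype.card ι • g x := by
  have : ∀ i, ∑ j, s.u i j • f (s.v i j • x) = g x := fun i => by
    have : ∀ j, f (s.v i j • x) = s.v i j • g x := fun j => by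
      rw [h _ (K.smul_mem _ hx), map_smul]
    simp_rw [this, ← mul_smul, ← Finset.sum_smul, s.sum_mul, one_smul]
  simp [trace_apply, this]

theorem trace_mem {f : M →ₗ[B₀] N} {K : Submodule A N} (h : ∀ x, f x ∈ K) (x : M) :
    s.trace f x ∈ K :=
  K.sum_mem fun _ _ => K.sum_mem fun _ _ => K.smul_mem _ (h _)

end Trace

/-! ### Projective A-modules are projective over B. -/

section Projective

/-- The inner sum over `j` recovers the component of `a` of degree `-i`. Thus the `v_{ij}` and the
functionals `a ↦ projZero (a u_{ij})` form a dual basis of A over B. -/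
theorem sum_projZero_mul [Fintype ι] (a : A) :
    ∑ i, ∑ j, (projZero 𝒜 (a * s.u i j) : A) * s.v i j = a := by
  simp_rw [coe_projZero_mul 𝒜 a (s.u_mem _ _), mul_assoc, ← Finset.mul_sum, s.sum_mul, mul_one]
  exact sum_decompose_neg a

/-- The coordinates of an element in the generating family `v_{ij}`. -/
def coords : A →ₗ[B₀] ((Σ i, Fin (s.size i)) → B₀) :=
  LinearMap.pi fun p =>
    { toFun := fun a => projZero 𝒜 (a * s.u p.1 p.2)
      map_add' := fun a b => by rw [add_mul, map_add]
      map_smul' := fun b a => by rw [smul_mul_assoc, map_smul, RingHom.id_apply] }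

theorem lsum_comp_coords [Fintype ι] :
    (Fintype.linearCombination B₀ fun p : Σ i, Fin (s.size i) => s.v p.1 p.2) ∘ₗ s.coords =
      LinearMap.id := by
  refine LinearMap.ext fun a => ?_
  rw [LinearMap.comp_apply, Fintype.linearCombination_apply, Fintype.sum_sigma]
  exact s.sum_projZero_mul a

theorem projective_self (s : HomogeneousDualBasis 𝒜) [Finite ι] : Module.Projective B₀ A :=
  have := Fintype.ofFinite ι
  Module.Projective.of_split _ _ s.lsum_comp_coords

/-- `P` is a retract of a free A-module, which is a direct sum of copies of the projective B-module
A. -/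
theorem projective (s : HomogeneousDualBasis 𝒜) [Finite ι] (P : Type*) [AddCommGroup P]
    [Module A P] [Module.Projective A P] : Module.Projective B₀ P := by
  have := s.projective_self
  obtain ⟨t, ht⟩ := Module.projective_def'.1 ‹Module.Projective A P›
  have : Module.Projective B₀ (P →₀ A) := by
    classical
    exact Module.Projective.of_equiv' (finsuppLequivDFinsupp B₀ (ι := P) (M := A)).symm
  refine Module.Projective.of_split (t.restrictScalars B₀)
    ((Finsupp.linearCombination A id).restrictScalars B₀) ?_
  exact LinearMap.ext fun x => LinearMap.congr_fun ht x

end Projective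

end HomogeneousDualBasis

/-! ### Comparison of Hom_A(M, A) with Hom_B(M, B). -/

section Dual

variable (𝒜) (M : Type*) [AddCommGroup M] [Module A M]

/-- The map `Hom_A(M, A) → Hom_{A_0}(M, A_0)` induced by the projection `A → A_0`. -/
def dualRestrict : (M →ₗ[A] A) →+ (M →ₗ[B₀] B₀) where
  toFun F := projZero 𝒜 ∘ₗ F.restrictScalars B₀
  map_zero' := LinearMap.ext fun _ => map_zero (projZero 𝒜)
  map_add' _ _ := LinearMap.ext fun _ => map_add (projZero 𝒜) _ _

variable {M}

theorem dualRestrict_apply (F : M →ₗ[A] A) (x : M) : dualRestrict 𝒜 M F x = projZero 𝒜 (F x) := rfl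

variable {𝒜}

/-- If the projection of `F` vanishes at every `v x`, then each component of `F x` is killed by the
`v` of the opposite degree, hence by `∑ u v = 1`. -/
theorem dualRestrict_injective (s : HomogeneousDualBasis 𝒜) [Finite ι] :
    Function.Injective (dualRestrict 𝒜 M) := by
  have := Fintype.ofFinite ι
  refine (injective_iff_map_eq_zero _).2 fun F hF => LinearMap.ext fun x => ?_
  rw [LinearMap.zero_apply, ← sum_decompose_neg (𝒜 := 𝒜) (F x)]
  refine Finset.sum_eq_zero fun i _ => ?_
  rw [← one_mul (DirectSum.decompose 𝒜 (F x) (-i) : A), ← s.sum_mul (-i), Finset.sum_mul]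
  refine Finset.sum_eq_zero fun j _ => ?_
  have h : dualRestrict 𝒜 M F (s.v (-i) j • x) = 0 := by rw [hF]; rfl
  rw [dualRestrict_apply, map_smul, smul_eq_mul] at h
  have h' := coe_projZero_mul' 𝒜 (F x) (s.v_mem (-i) j)
  rw [h, neg_neg] at h'
  rw [mul_assoc, ← h', ZeroMemClass.coe_zero, mul_zero]

/-- The trace of `f`, viewed as a map to A, is a preimage: its `i`-th part lies in degree `i`, so
only `i = 0` survives projection, and that part is `f x` by B-linearity. -/
theorem dualRestrict_surjective (s : HomogeneousDualBasis 𝒜) [Finite ι] :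
    Function.Surjective (dualRestrict 𝒜 M) := by
  have := Fintype.ofFinite ι
  intro f
  let incl : B₀ →ₗ[B₀] A :=
    { toFun := fun b => b, map_add' := fun _ _ => rfl, map_smul' := fun _ _ => rfl }
  refine ⟨s.trace (incl ∘ₗ f), LinearMap.ext fun x => ?_⟩
  rw [dualRestrict_apply, s.trace_apply, map_sum, Finset.sum_eq_single 0]
  · have hv : ∀ j, s.v 0 j ∈ B₀ := fun j => by
      have := s.v_mem 0 j
      rwa [neg_zero] at this
    have : ∑ j, s.u 0 j • (incl ∘ₗ f) (s.v 0 j • x) = (f x : A) := by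
      have : ∀ j, (incl ∘ₗ f) (s.v 0 j • x) = s.v 0 j * (f x : A) := fun j =>
        congrArg Subtype.val (f.map_smul ⟨_, hv j⟩ x)
      simp_rw [this, smul_eq_mul, ← mul_assoc, ← Finset.sum_mul, s.sum_mul, one_mul]
    rw [this, projZero_coe]
  · intro i _ hi
    refine projZero_of_mem_ne 𝒜 (i := i) (sum_mem fun j _ => ?_) hi
    have := SetLike.mul_mem_graded (s.u_mem i j) (f (s.v i j • x)).2
    rwa [add_zero] at this
  · exact fun h => absurd (Finset.mem_univ _) h

theorem dualRestrict_bijective [FiniteDimensional k A] (s : HomogeneousDualBasis 𝒜) :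
    Function.Bijective (dualRestrict 𝒜 M) := by
  rcases subsingleton_or_nontrivial A with h | h
  · have hB : Subsingleton B₀ := Subtype.val_injective.subsingleton
    exact ⟨fun F F' _ => LinearMap.ext fun _ => Subsingleton.elim _ _,
      fun f => ⟨0, LinearMap.ext fun _ => Subsingleton.elim _ _⟩⟩
  · have := s.finite_index
    exact ⟨dualRestrict_injective s, dualRestrict_surjective s⟩

end Dual

/-! ### Maschke's theorem for strongly graded algebras. -/

section Maschke

/-- The trace of a B-linear projector onto `K` is A-linear, has values in `K` and is multiplication
by the group order on `K`; as the order is invertible, its kernel is a complement. -/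
theorem isSemisimpleModule_of_zero (s : HomogeneousDualBasis 𝒜) [Finite ι]
    (hι : IsUnit (Nat.card ι : k)) (N : Type*) [AddCommGroup N] [Module A N]
    [IsSemisimpleModule B₀ N] : IsSemisimpleModule A N := by
  have := Fintype.ofFinite ι
  obtain ⟨c, hc⟩ : ∃ c : A, c * (Nat.card ι : A) = 1 := by
    obtain ⟨c, hc⟩ := hι.exists_left_inv
    exact ⟨algebraMap k A c, by rw [← map_natCast (algebraMap k A), ← map_mul, hc, map_one]⟩
  have hcard : ∀ y : N, c • Fintype.card ι • y = y := fun y => by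
    rw [← Nat.cast_smul_eq_nsmul A, ← mul_smul, ← Nat.card_eq_fintype_card, hc, one_smul]
  rw [isSemisimpleModule_iff]
  refine ⟨fun K => ?_⟩
  obtain ⟨C, hC⟩ := exists_isCompl (K.restrictScalars B₀)
  let q : N →ₗ[B₀] N := (K.restrictScalars B₀).subtype ∘ₗ Submodule.projectionOnto _ _ hC
  have hqK : ∀ x ∈ K, q x = (LinearMap.id : N →ₗ[A] N) x := fun x hx =>
    congrArg Subtype.val (Submodule.projectionOnto_apply_left hC ⟨x, hx⟩)
  have hq : ∀ x, q x ∈ K := fun x => (Submodule.projectionOnto _ _ hC x).2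
  refine ⟨LinearMap.ker (s.trace q), ?_, ?_⟩
  · rw [Submodule.disjoint_def]
    intro x hx hx'
    rw [LinearMap.mem_ker, s.trace_apply_of_mem _ hqK hx, LinearMap.id_apply] at hx'
    rw [← hcard x, hx', smul_zero]
  · rw [codisjoint_iff, eq_top_iff]
    intro x _
    have hy : c • s.trace q x ∈ K := K.smul_mem _ (s.trace_mem hq x)
    refine Submodule.mem_sup.2 ⟨_, hy, x - c • s.trace q x, ?_, by abel⟩
    rw [LinearMap.mem_ker, map_sub, map_smul, s.trace_apply_of_mem _ hqK (s.trace_mem hq x),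
      LinearMap.id_apply, hcard, sub_self]

end Maschke

/-! ### Superfluous submodules under restriction to B. -/

section Superfluous

variable (𝒜) {M : Type*} [AddCommGroup M] [Module A M]

/-- The elements `x` with `A_i x ⊆ L`. -/
def twist (i : ι) (L : Submodule B₀ M) : Submodule B₀ M where
  carrier := {x | ∀ a ∈ 𝒜 i, a • x ∈ L}
  zero_mem' a _ := by rw [smul_zero]; exact L.zero_mem
  add_mem' hx hy a ha := by rw [smul_add]; exact L.add_mem (hx a ha) (hy a ha)
  smul_mem' b x hx a ha := by
    rw [Subalgebra.smul_def, ← mul_smul]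
    refine hx _ ?_
    have := SetLike.mul_mem_graded ha b.2
    rwa [add_zero] at this

variable {𝒜}

theorem mem_twist {i : ι} {L : Submodule B₀ M} {x : M} :
    x ∈ twist 𝒜 i L ↔ ∀ a ∈ 𝒜 i, a • x ∈ L := Iff.rfl

theorem twist_zero (L : Submodule B₀ M) : twist 𝒜 0 L = L := by
  ext x
  refine ⟨fun h => ?_, fun h a ha => L.smul_mem ⟨a, ha⟩ h⟩
  simpa using h 1 (SetLike.one_mem_graded 𝒜)

/-- By strongness, `𝒜 (j + i)` is spanned by the products. Hence `twist` by `i` and by `-i` are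
mutually inverse lattice automorphisms, which preserve maximal submodules. -/
theorem twist_twist (h : ∀ i j, 𝒜 i * 𝒜 j = 𝒜 (i + j)) (i j : ι) (L : Submodule B₀ M) :
    twist 𝒜 i (twist 𝒜 j L) = twist 𝒜 (j + i) L := by
  ext x
  simp only [mem_twist, ← mul_smul]
  refine ⟨fun hx a ha => ?_, fun hx a ha b hb => hx _ (SetLike.mul_mem_graded hb ha)⟩
  rw [← h] at ha
  induction ha using Submodule.mul_induction_on' with
  | mem_mul_mem m hm n hn => exact hx n hn m hm
  | add a _ b _ iha ihb => rw [add_smul]; exact L.add_mem iha ihb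

theorem twist_mono (i : ι) {L L' : Submodule B₀ M} (h : L ≤ L') : twist 𝒜 i L ≤ twist 𝒜 i L' :=
  fun _ hx a ha => h (hx a ha)

theorem isCoatom_twist (h : ∀ i j, 𝒜 i * 𝒜 j = 𝒜 (i + j)) (i : ι) {L : Submodule B₀ M}
    (hL : IsCoatom L) : IsCoatom (twist 𝒜 i L) := by
  let e : Submodule B₀ M ≃o Submodule B₀ M :=
    { toFun := twist 𝒜 i
      invFun := twist 𝒜 (-i)
      left_inv := fun L => by rw [twist_twist h, add_neg_cancel, twist_zero]
      right_inv := fun L => by rw [twist_twist h, neg_add_cancel, twist_zero]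
      map_rel_iff' := by
        intro L L'
        refine ⟨fun hLL => ?_, twist_mono i⟩
        have := twist_mono (-i) hLL
        simpa only [Equiv.coe_fn_mk, twist_twist h, add_neg_cancel, twist_zero] using this }
  exact (e.isCoatom_iff L).2 hL

variable (A) in
/-- The largest `A`-submodule contained in a submodule over the component of degree `0`. -/
def core (B : Subalgebra k A) {M : Type*} [AddCommGroup M] [Module A M]
    (L : Submodule B M) : Submodule A M where
  carrier := {x | ∀ a : A, a • x ∈ L}
  zero_mem' a := by rw [smul_zero]; exact L.zero_mem
  add_mem' hx hy a := by rw [smul_add]; exact L.add_mem (hx a) (hy a)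
  smul_mem' b x hx a := by rw [← mul_smul]; exact hx _

theorem mem_core_iff {L : Submodule B₀ M} {x : M} : x ∈ core A B₀ L ↔ ∀ i, x ∈ twist 𝒜 i L := by
  refine ⟨fun h i a _ => h a, fun h a => ?_⟩
  induction a using DirectSum.Decomposition.inductionOn 𝒜 with
  | zero => rw [zero_smul]; exact L.zero_mem
  | homogeneous a => exact h _ _ a.2
  | add a b ha hb => rw [add_smul]; exact L.add_mem ha hb

/-- The core is the intersection of the finitely many twists of `L`, all maximal, so the quotient
embeds in a finite product of simple modules. -/
theorem isSemisimpleModule_quotient_core [Finite ι] (h : ∀ i j, 𝒜 i * 𝒜 j = 𝒜 (i + j))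
    {L : Submodule B₀ M} (hL : IsCoatom L) : IsSemisimpleModule B₀ (M ⧸ core A B₀ L) := by
  have : ∀ i, IsSimpleModule B₀ (M ⧸ twist 𝒜 i L) := fun i =>
    isSimpleModule_iff_isCoatom.2 (isCoatom_twist h i hL)
  let φ : M →ₗ[B₀] ∀ i, M ⧸ twist 𝒜 i L := LinearMap.pi fun i => (twist 𝒜 i L).mkQ
  have hφ : LinearMap.ker φ = (core A B₀ L).restrictScalars B₀ := by
    ext x
    rw [Submodule.restrictScalars_mem, mem_core_iff, LinearMap.mem_ker]
    simp only [φ, funext_iff, LinearMap.pi_apply, Pi.zero_apply, Submodule.mkQ_apply,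
      Submodule.Quotient.mk_eq_zero]
  have : IsSemisimpleModule B₀ (M ⧸ (core A B₀ L).restrictScalars B₀) := by
    rw [← hφ]
    exact IsSemisimpleModule.of_injective ((LinearMap.ker φ).liftQ φ le_rfl)
      (LinearMap.ker_eq_bot.1 (Submodule.ker_liftQ_eq_bot _ _ _ le_rfl))
  exact this.congr (Submodule.Quotient.restrictScalarsEquiv B₀ (core A B₀ L)).symm

/-- Enlarge a proper `L` to a maximal `L'` and let `D` be its core. Then `M ⧸ D` is semisimple over
A, so the image of `K` has a complement `C`. The preimage of `C` and `K` together span `M`, so that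
preimage is all of `M`; this forces `K ≤ D ≤ L'`, whence `L' = M`. -/
theorem superfluous_zero (s : HomogeneousDualBasis 𝒜) [Finite ι]
    (h : ∀ i j, 𝒜 i * 𝒜 j = 𝒜 (i + j)) (hι : IsUnit (Nat.card ι : k)) [Module.Finite B₀ M]
    {K : Submodule A M} (hK : ∀ L : Submodule A M, L ⊔ K = ⊤ → L = ⊤) (L : Submodule B₀ M)
    (hL : L ⊔ K.restrictScalars B₀ = ⊤) : L = ⊤ := by
  by_contra hne
  obtain ⟨L', hL', hLL'⟩ := (eq_top_or_exists_le_coatom L).resolve_left hne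
  refine hL'.1 ?_
  have hsup : L' ⊔ K.restrictScalars B₀ = ⊤ := top_le_iff.1 (hL ▸ sup_le_sup_right hLL' _)
  let D : Submodule A M := core A B₀ L'
  have hDL : D.restrictScalars B₀ ≤ L' := fun x hx => by simpa using hx 1
  have := isSemisimpleModule_quotient_core h hL'
  have := isSemisimpleModule_of_zero s hι (M ⧸ D)
  obtain ⟨C, hC⟩ := exists_isCompl (K.map D.mkQ)
  have hCtop : C.comap D.mkQ = ⊤ := by
    refine hK _ (top_le_iff.1 fun x _ => ?_)
    have hx : D.mkQ x ∈ K.map D.mkQ ⊔ C := hC.sup_eq_top ▸ Submodule.mem_top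
    obtain ⟨_, ⟨y, hy, rfl⟩, z, hz, hyz⟩ := Submodule.mem_sup.1 hx
    refine Submodule.mem_sup.2 ⟨x - y, ?_, y, hy, by abel⟩
    rw [Submodule.mem_comap, map_sub, ← hyz, add_sub_cancel_left]
    exact hz
  have hKD : K ≤ D := fun x hx => by
    have h1 : D.mkQ x ∈ K.map D.mkQ := Submodule.mem_map_of_mem hx
    have h2 : x ∈ C.comap D.mkQ := hCtop ▸ Submodule.mem_top
    have h3 := (Submodule.disjoint_def.1 hC.disjoint) _ h1 h2
    simpa using h3
  rw [← hsup, sup_eq_left.2]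
  exact fun x hx => hDL (hKD hx)

end Superfluous

end AddGroup

end StronglyGraded

/-! ### Uniqueness of projective covers and minimal presentations. -/

section Uniqueness

variable {R : Type u} [Ring R]

/-- Projective covers of isomorphic modules are isomorphic. -/
theorem IsProjectiveCover.exists_equiv {P P' M M' : Type*} [AddCommGroup P] [Module R P]
    [AddCommGroup P'] [Module R P'] [AddCommGroup M] [Module R M] [AddCommGroup M'] [Module R M']
    {π : P →ₗ[R] M} {π' : P' →ₗ[R] M'} (h : IsProjectiveCover π) (h' : IsProjectiveCover π')
    (e : M ≃ₗ[R] M') : ∃ φ : P ≃ₗ[R] P', ∀ x, π' (φ x) = e (π x) := by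
  have := h.projective
  have := h'.projective
  obtain ⟨φ, hφ⟩ := Module.projective_lifting_property π' (e.toLinearMap ∘ₗ π) h'.surjective
  have hφ' : ∀ x, π' (φ x) = e (π x) := fun x => LinearMap.congr_fun hφ x
  have hsurj : Function.Surjective φ := by
    rw [← LinearMap.range_eq_top]
    refine h'.superfluous _ (top_le_iff.1 fun y _ => ?_)
    obtain ⟨x, hx⟩ := h.surjective (e.symm (π' y))
    refine Submodule.mem_sup.2 ⟨φ x, ⟨x, rfl⟩, y - φ x, ?_, by abel⟩
    rw [LinearMap.mem_ker, map_sub, hφ', hx, e.apply_symm_apply, sub_self]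
  obtain ⟨ψ, hψ⟩ := Module.projective_lifting_property φ LinearMap.id hsurj
  have hψ' : ∀ y, φ (ψ y) = y := fun y => LinearMap.congr_fun hψ y
  -- The section `ψ` is onto because `ker φ` lies in the superfluous `ker π`; this makes `φ`
  -- injective.
  have hψtop : LinearMap.range ψ = ⊤ := by
    refine h.superfluous _ (top_le_iff.1 fun x _ => ?_)
    refine Submodule.mem_sup.2 ⟨ψ (φ x), ⟨_, rfl⟩, x - ψ (φ x), ?_, by abel⟩
    rw [LinearMap.mem_ker, ← e.map_eq_zero_iff, ← hφ', map_sub, hψ', sub_self, map_zero]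
  have hinj : Function.Injective φ := by
    refine (injective_iff_map_eq_zero φ).2 fun x hx => ?_
    obtain ⟨y, rfl⟩ := LinearMap.range_eq_top.1 hψtop x
    rw [hψ'] at hx
    rw [hx, map_zero]
  exact ⟨LinearEquiv.ofBijective φ ⟨hinj, hsurj⟩, hφ'⟩

/-- Precomposition with an isomorphism, as an isomorphism of `R`-duals. -/
def ringDualCongr {P P' : Type*} [AddCommGroup P] [Module R P] [AddCommGroup P'] [Module R P']
    (e : P ≃ₗ[R] P') : (P' →ₗ[R] R) ≃ₗ[Rᵐᵒᵖ] (P →ₗ[R] R) where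
  toFun f := f ∘ₗ e.toLinearMap
  invFun f := f ∘ₗ e.symm.toLinearMap
  map_add' _ _ := rfl
  map_smul' _ _ := rfl
  left_inv f := LinearMap.ext fun x => congrArg f (e.apply_symm_apply x)
  right_inv f := LinearMap.ext fun x => congrArg f (e.symm_apply_apply x)

/-- The cokernel of `P₀^* → P₁^*` does not depend on the minimal projective presentation. -/
theorem MinimalPresentation.nonempty_cokerDual_iso {M : Type v} [AddCommGroup M] [Module R M]
    (p q : MinimalPresentation R M) : Nonempty (p.cokerDual ≅ q.cokerDual) := by
  obtain ⟨φ₀, h₀⟩ := p.cover₀.exists_equiv q.cover₀ (LinearEquiv.refl R M)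
  have hmap : (LinearMap.range p.d).map φ₀.toLinearMap = LinearMap.range q.d := by
    rw [p.exact, q.exact]
    ext y
    constructor
    · rintro ⟨x, hx, rfl⟩
      exact (h₀ x).trans hx
    · intro hy
      refine ⟨φ₀.symm y, ?_, φ₀.apply_symm_apply y⟩
      have := h₀ (φ₀.symm y)
      rw [φ₀.apply_symm_apply] at this
      exact this.symm.trans hy
  obtain ⟨φ₁, h₁⟩ := p.cover₁.exists_equiv q.cover₁ (φ₀.ofSubmodules _ _ hmap)
  have hd : ∀ x, q.d (φ₁ x) = φ₀ (p.d x) := fun x => congrArg Subtype.val (h₁ x)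
  refine ⟨LinearEquiv.toModuleIso (LinearEquiv.symm (Submodule.Quotient.equiv _ _
    (ringDualCongr φ₁) ?_))⟩
  ext f
  constructor
  · rintro ⟨_, ⟨g, rfl⟩, rfl⟩
    exact ⟨ringDualCongr φ₀ g, LinearMap.ext fun x => congrArg g (hd x).symm⟩
  · rintro ⟨g, rfl⟩
    refine ⟨_, ⟨(ringDualCongr φ₀).symm g, rfl⟩, LinearMap.ext fun x => ?_⟩
    refine (congrArg ((ringDualCongr φ₀).symm g) (hd x)).trans ?_
    exact congrArg g (φ₀.symm_apply_apply (p.d x))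

end Uniqueness

/-! ### The k-dual and restriction. -/

section Duals

variable (k : Type w) [Field k] {A : Type u} [Ring A] [Algebra k A]

/-- The `k`-dual commutes with restriction to a subalgebra. -/
theorem nonempty_kDual_res_iso (B : Subalgebra k A) (X : ModuleCat.{v} A) :
    Nonempty (kDual k (res B X) ≅ resRight B (kDual k X)) :=
  -- Both sides are the same space of functionals with the same action of B.
  ⟨Iso.refl _⟩

/-- The `k`-dual of right modules commutes with restriction to a subalgebra. -/
theorem nonempty_kDualRight_resRight_iso (B : Subalgebra k A) (Y : ModuleCat.{v} Aᵐᵒᵖ) :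
    Nonempty (kDualRight k (resRight B Y) ≅ res B (kDualRight k Y)) :=
  ⟨Iso.refl _⟩

/-- The `k`-dual of right modules preserves isomorphisms. -/
theorem nonempty_kDualRight_iso {Y Y' : ModuleCat.{v} Aᵐᵒᵖ} (e : Y ≅ Y') :
    Nonempty (kDualRight k Y ≅ kDualRight k Y') := by
  let _ := kDualRightModule k Y
  let _ := kDualRightModule k Y'
  let l := e.toLinearEquiv
  have hk : ∀ {Z Z' : ModuleCat.{v} Aᵐᵒᵖ} (f : Z →ₗ[Aᵐᵒᵖ] Z') (c : k) (z : Z),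
      f (c • z) = c • f z := fun f c z => f.map_smul (algebraMap k Aᵐᵒᵖ c) z
  let l' : Y ≃ₗ[k] Y' := { l with map_smul' := hk l.toLinearMap }
  let d : (Y →ₗ[k] k) ≃ₗ[A] (Y' →ₗ[k] k) :=
    { toFun := fun f => f ∘ₗ l'.symm.toLinearMap
      invFun := fun f => f ∘ₗ l'.toLinearMap
      map_add' := fun _ _ => rfl
      map_smul' := fun a f => LinearMap.ext fun y =>
        congrArg f (l.symm.map_smul (MulOpposite.op a) y).symm
      left_inv := fun f => LinearMap.ext fun y => congrArg f (l.symm_apply_apply y)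
      right_inv := fun f => LinearMap.ext fun y => congrArg f (l.apply_symm_apply y) }
  exact ⟨d.toModuleIso⟩

theorem nonempty_kDualRight_res_iso {B : Subalgebra k A} {Y : ModuleCat.{v} (↥B)ᵐᵒᵖ}
    {Z : ModuleCat.{v} Aᵐᵒᵖ} (h : Nonempty (Y ≅ resRight B Z)) :
    Nonempty (kDualRight k Y ≅ res B (kDualRight k Z)) := by
  obtain ⟨e⟩ := h
  obtain ⟨e₁⟩ := nonempty_kDualRight_iso k e
  obtain ⟨e₂⟩ := nonempty_kDualRight_resRight_iso k B Z
  exact ⟨e₁ ≪≫ e₂⟩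

end Duals

/-! ### Restriction of duals, presentations and transposes. -/

section StronglyGradedRestriction

variable {k : Type w} [Field k] {A : Type u} [Ring A] [Algebra k A] {G : Type*} [Group G]
  [DecidableEq G] {𝒜 : Additive G → Submodule k A} [GradedAlgebra 𝒜]

theorem IsStronglyGraded.mul_eq {G : Type*} [Group G] {𝒜 : Additive G → Submodule k A}
    (h : IsStronglyGraded 𝒜) (i j : Additive G) :
    𝒜 i * 𝒜 j = 𝒜 (i + j) :=
  h i.toMul j.toMul

variable (𝒜) in
/-- The map `Hom_A(X, A) → Hom_B(X, B)` induced by the projection `A → B`, as a map of right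
`B`-modules. -/
def ringDualRestrict (X : ModuleCat.{v} A) :
    resRight (oneComponent 𝒜) (ringDual X) →ₗ[(oneComponent 𝒜)ᵐᵒᵖ]
      ringDual (res (oneComponent 𝒜) X) where
  toFun F := dualRestrict 𝒜 X (F : X →ₗ[A] A)
  map_add' F F' := (dualRestrict 𝒜 X).map_add F F'
  map_smul' b F := LinearMap.ext fun x => projZero_mul_coe 𝒜 ((show X →ₗ[A] A from F) x) b.unop

theorem ringDualRestrict_bijective [FiniteDimensional k A] (h : IsStronglyGraded 𝒜)
    (X : ModuleCat.{v} A) : Function.Bijective (ringDualRestrict 𝒜 X) :=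
  let ⟨s⟩ := nonempty_homogeneousDualBasis 𝒜 h.mul_eq
  dualRestrict_bijective (M := X) s

theorem nonempty_ringDual_res_iso [FiniteDimensional k A] (h : IsStronglyGraded 𝒜)
    (X : ModuleCat.{v} A) :
    Nonempty (ringDual (res (oneComponent 𝒜) X) ≅ resRight (oneComponent 𝒜) (ringDual X)) :=
  ⟨(LinearEquiv.ofBijective _ (ringDualRestrict_bijective h X)).symm.toModuleIso⟩

/-- An `A`-linear map, as a map of modules over a subalgebra. -/
def resMap (B : Subalgebra k A) {X : ModuleCat.{v} A} {M : Type*} [AddCommGroup M] [Module A M]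
    (f : X →ₗ[A] M) : res B X →ₗ[B] res B (ModuleCat.of A M) where
  toFun := f
  map_add' := f.map_add
  map_smul' b x := f.map_smul b.1 x

theorem isProjectiveCover_res [FiniteDimensional k A] (h : IsStronglyGraded 𝒜) [Finite G]
    (hG : IsUnit (Nat.card G : k)) {P : ModuleCat.{v} A} {M : Type*} [AddCommGroup M] [Module A M]
    {π : P →ₗ[A] M} (hπ : IsProjectiveCover π) :
    IsProjectiveCover (resMap (oneComponent 𝒜) π) := by
  obtain ⟨s⟩ := nonempty_homogeneousDualBasis 𝒜 h.mul_eq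
  have := hπ.finite
  have := hπ.projective
  have : Finite (Additive G) := ‹Finite G›
  have hfin : Module.Finite (oneComponent 𝒜) (res (oneComponent 𝒜) P) := inferInstance
  have hfin' : Module.Finite (SetLike.GradeZero.subalgebra 𝒜) P := hfin
  refine ⟨hfin, s.projective P, hπ.surjective,
    fun L hL => ?_⟩
  have hsup : ∀ x : res (oneComponent 𝒜) P,
      ∃ y ∈ L, ∃ z ∈ LinearMap.ker (resMap (oneComponent 𝒜) π), y + z = x := fun x =>
    Submodule.mem_sup.1 (hL ▸ Submodule.mem_top : x ∈ L ⊔ LinearMap.ker (resMap _ π))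
  let L' : Submodule (SetLike.GradeZero.subalgebra 𝒜) P :=
    { carrier := {x | x ∈ L}
      zero_mem' := L.zero_mem
      add_mem' := L.add_mem
      smul_mem' := fun b _ hx => L.smul_mem b hx }
  have hL' : L' ⊔ (LinearMap.ker π).restrictScalars (SetLike.GradeZero.subalgebra 𝒜) = ⊤ := by
    refine top_le_iff.1 fun x _ => ?_
    obtain ⟨y, hy, z, hz, hyz⟩ := hsup x
    exact Submodule.mem_sup.2 ⟨y, hy, z, hz, hyz⟩
  have htop := superfluous_zero (M := P) s h.mul_eq
    (show IsUnit (Nat.card (Additive G) : k) from hG) hπ.superfluous L' hL'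
  have hmem : ∀ x : P, x ∈ L' := fun x => htop ▸ Submodule.mem_top
  exact top_le_iff.1 fun x _ => hmem x

/-- The restriction of a minimal projective presentation to the component of degree `1`. -/
noncomputable def MinimalPresentation.restrict [FiniteDimensional k A]
    (h : IsStronglyGraded 𝒜) [Finite G] (hG : IsUnit (Nat.card G : k)) {X : ModuleCat.{v} A}
    (p : MinimalPresentation A X) :
    MinimalPresentation (oneComponent 𝒜) (res (oneComponent 𝒜) X) where
  P₁ := res _ p.P₁
  P₀ := res _ p.P₀
  d := resMap _ p.d
  ε := resMap _ p.ε
  exact := SetLike.ext fun x => SetLike.ext_iff.1 p.exact x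
  cover₀ := isProjectiveCover_res h hG p.cover₀
  cover₁ :=
    have c := isProjectiveCover_res h hG p.cover₁
    { finite := c.finite
      projective := c.projective
      surjective := LinearMap.surjective_rangeRestrict _
      superfluous := fun L hL => c.superfluous L (by
        rw [← hL]
        congr 1) }

theorem MinimalPresentation.nonempty_cokerDual_restrict_iso [FiniteDimensional k A]
    (h : IsStronglyGraded 𝒜) [Finite G] (hG : IsUnit (Nat.card G : k)) {X : ModuleCat.{v} A}
    (p : MinimalPresentation A X) :
    Nonempty ((p.restrict h hG).cokerDual ≅ resRight (oneComponent 𝒜) p.cokerDual) := by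
  let e₁ := LinearEquiv.ofBijective _ (ringDualRestrict_bijective h p.P₁)
  let e₀ := LinearEquiv.ofBijective _ (ringDualRestrict_bijective h p.P₀)
  let dA : ringDual p.P₀ →ₗ[Aᵐᵒᵖ] ringDual p.P₁ := p.dualMap
  let dB : ringDual (res (oneComponent 𝒜) p.P₀) →ₗ[(oneComponent 𝒜)ᵐᵒᵖ]
    ringDual (res (oneComponent 𝒜) p.P₁) := (p.restrict h hG).dualMap
  let q : resRight (oneComponent 𝒜) (ringDual p.P₁) →ₗ[(oneComponent 𝒜)ᵐᵒᵖ]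
      resRight (oneComponent 𝒜) p.cokerDual :=
    { toFun := (LinearMap.range dA).mkQ
      map_add' := map_add _
      map_smul' := fun b F => map_smul (LinearMap.range dA).mkQ (MulOpposite.op (b.unop : A)) F }
  have hq : ∀ F, q F = 0 ↔ ∃ F' : ringDual p.P₀, dA F' = F := fun F =>
    Submodule.Quotient.mk_eq_zero _
  -- Both sides are `F` precomposed with `d` and followed by the projection to B.
  have hnat : ∀ F, e₁ (dA F) = dB (e₀ F) := fun F => rfl
  let φ := q ∘ₗ e₁.symm.toLinearMap
  have hφ : Function.Surjective φ :=
    (Submodule.mkQ_surjective (LinearMap.range dA)).comp e₁.symm.surjective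
  have hker : LinearMap.range dB = LinearMap.ker φ := by
    ext f
    refine Iff.trans ?_ (hq (e₁.symm f)).symm
    constructor
    · rintro ⟨g, rfl⟩
      refine ⟨e₀.symm g, e₁.injective ((hnat _).trans ?_)⟩
      rw [e₁.apply_symm_apply]
      exact congrArg dB (e₀.apply_symm_apply g)
    · rintro ⟨F, hF⟩
      exact ⟨e₀ F, (hnat F).symm.trans ((congrArg e₁ hF).trans (e₁.apply_symm_apply f))⟩
  exact ⟨((Submodule.quotEquivOfEq _ _ hker).trans (φ.quotKerEquivOfSurjective hφ)).toModuleIso⟩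

theorem nonempty_transpose_res_iso [FiniteDimensional k A] (h : IsStronglyGraded 𝒜)
    (hG : IsUnit (Nat.card G : k)) (X : ModuleCat.{v} A) [Module.Finite A X] :
    Nonempty (transpose k (res (oneComponent 𝒜) X) ≅
      resRight (oneComponent 𝒜) (transpose k X)) := by
  -- `Nat.card` is `0` on an infinite group, and `0` is not a unit of `k`.
  have : Finite G := Nat.finite_of_card_ne_zero fun h0 => by simp [h0] at hG
  obtain ⟨e⟩ := (minimalPresentation k (res (oneComponent 𝒜) X)).nonempty_cokerDual_iso
    ((minimalPresentation k X).restrict h hG)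
  obtain ⟨e'⟩ := (minimalPresentation k X).nonempty_cokerDual_restrict_iso h hG
  exact ⟨e ≪≫ e'⟩

end StronglyGradedRestriction

end GrRes
open GrRes in
theorem proposition3p7 {k : Type w} [Field k] {A : Type u} [Ring A] [Algebra k A]
    [FiniteDimensional k A] {G : Type*} [Group G] [DecidableEq G]
    (𝒜 : Additive G → Submodule k A) [GradedAlgebra 𝒜] (hA : IsStronglyGraded 𝒜)
    (X : ModuleCat.{v} A) [Module.Finite A X] :
    Nonempty (kDual k (res (oneComponent 𝒜) X) ≅ resRight (oneComponent 𝒜) (kDual k X)) ∧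
    Nonempty (ringDual (res (oneComponent 𝒜) X) ≅ resRight (oneComponent 𝒜) (ringDual X)) ∧
    Nonempty (nakayama k (res (oneComponent 𝒜) X) ≅ res (oneComponent 𝒜) (nakayama k X)) ∧
    (IsSelfInjective (oneComponent 𝒜) → IsUnit (Nat.card G : k) →
      Nonempty (transpose k (res (oneComponent 𝒜) X) ≅
        resRight (oneComponent 𝒜) (transpose k X)) ∧
      Nonempty (arTranslation k (res (oneComponent 𝒜) X) ≅
        res (oneComponent 𝒜) (arTranslation k X))) := by
  have h₂ := nonempty_ringDual_res_iso hA X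
  refine ⟨nonempty_kDual_res_iso k _ X, h₂, nonempty_kDualRight_res_iso k h₂, fun _ hG => ?_⟩
  have h₄ := nonempty_transpose_res_iso hA hG X
  exact ⟨h₄, nonempty_kDualRight_res_iso k h₄⟩
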